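/- Let $m>1$ be an integer and let $B(m,-m)=\langle a,b : a^{-1}b^{m}a=b^{-m}\rangle$ be the Baumslag–Solitar group. For an endomorphism $\phi$ of a group $G$, call $\alpha,\alpha'\in G$ $\phi$-conjugate if $\alpha'=\gamma\alpha\phi(\gamma)^{-1}$ for some $\gamma\in G$; the Reidemeister number $R(\phi)$ is the number of $\phi$-conjugacy classes in $G$. Then $R(\phi)=\infty$ for every automorphism $\phi$ of $B(m,-m)$. -/

import Mathlib

/-- Two elements `x`, `y` of `G` are `φ`-conjugate if `y = g * x * (φ g)⁻¹` for some `g`. -/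
def IsTwistedConj {G : Type*} [Group G] (φ : G →* G) (x y : G) : Prop :=
  ∃ g : G, y = g * x * (φ g)⁻¹

theorem isTwistedConj_equivalence {G : Type*} [Group G] (φ : G →* G) :
    Equivalence (IsTwistedConj φ) where
  refl x := ⟨1, by simp⟩
  symm := by
    rintro x y ⟨g, rfl⟩
    exact ⟨g⁻¹, by simp [mul_assoc]⟩
  trans := by
    rintro x y z ⟨g, rfl⟩ ⟨h, rfl⟩
    exact ⟨h * g, by simp [mul_assoc]⟩

/-- `φ`-conjugacy as an equivalence relation on `G`. -/
def twistedConjSetoid {G : Type*} [Group G] (φ : G →* G) : Setoid G where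
  r := IsTwistedConj φ
  iseqv := isTwistedConj_equivalence φ

/-- The Reidemeister number `R(φ)` of an endomorphism `φ`: the number of `φ`-conjugacy classes,
with value `⊤` when there are infinitely many. -/
noncomputable def reidemeisterNumber {G : Type*} [Group G] (φ : G →* G) : ℕ∞ :=
  ENat.card (Quotient (twistedConjSetoid φ))

/-- The relator of the presentation `⟨a, b : a⁻¹ b ^ m a = b ^ n⟩`, where the generators
`a`, `b` are indexed by `0`, `1`. -/
def baumslagSolitarRelator (m n : ℤ) : FreeGroup (Fin 2) :=
  (FreeGroup.of 0)⁻¹ * FreeGroup.of 1 ^ m * FreeGroup.of 0 * (FreeGroup.of 1 ^ n)⁻¹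

/-- The Baumslag-Solitar group `B(m,n) = ⟨a, b : a⁻¹ b ^ m a = b ^ n⟩`. -/
abbrev BaumslagSolitar (m n : ℤ) : Type :=
  PresentedGroup {baumslagSolitarRelator m n}

/-! Project to the Klein bottle group, with coordinates (x, s). Since s kills b under every
homomorphism (`map_b_s`), an automorphism φ acts on these coordinates by s ↦ d s and x ↦ y x + (k if
s is odd), with d, y = ±1 (`exists_endGraph`). If d = 1, s is constant on φ-conjugacy classes, so
the powers of a are inequivalent. If d = -1, twisted conjugacy between elements of equal s forces
s(g) = 0 for the conjugator g; for a suitable parity of t the contributions of g to x then cancel,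
so the b^n a^t are inequivalent. -/

/-- The fundamental group `ℤ ⋊ ℤ` of the Klein bottle: the second factor acts on the first
by sign. -/
@[ext]
structure KleinBottleGroup where
  /-- The coordinate in the normal factor. -/
  x : ℤ
  /-- The coordinate in the acting factor. -/
  s : ℤ

namespace KleinBottleGroup

/-- The sign by which an element acts on the normal factor. -/
def sign (p : KleinBottleGroup) : ℤ := (p.s.negOnePow : ℤ)

instance : Mul KleinBottleGroup := ⟨fun p q => ⟨p.x + p.sign * q.x, p.s + q.s⟩⟩

instance : One KleinBottleGroup := ⟨⟨0, 0⟩⟩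

instance : Inv KleinBottleGroup := ⟨fun p => ⟨-(p.sign * p.x), -p.s⟩⟩

@[simp] theorem mul_x (p q : KleinBottleGroup) : (p * q).x = p.x + p.sign * q.x := rfl

@[simp] theorem mul_s (p q : KleinBottleGroup) : (p * q).s = p.s + q.s := rfl

@[simp] theorem one_x : (1 : KleinBottleGroup).x = 0 := rfl

@[simp] theorem one_s : (1 : KleinBottleGroup).s = 0 := rfl

@[simp] theorem inv_x (p : KleinBottleGroup) : p⁻¹.x = -(p.sign * p.x) := rfl

@[simp] theorem inv_s (p : KleinBottleGroup) : p⁻¹.s = -p.s := rfl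

@[simp] theorem sign_mul (p q : KleinBottleGroup) : (p * q).sign = p.sign * q.sign := by
  simp [sign, Int.negOnePow_add]

@[simp] theorem sign_one : (1 : KleinBottleGroup).sign = 1 := by simp [sign]

@[simp] theorem sign_inv (p : KleinBottleGroup) : p⁻¹.sign = p.sign := by
  simp [sign, Int.negOnePow_neg]

theorem sign_mul_self (p : KleinBottleGroup) : p.sign * p.sign = 1 := by
  simp [sign, ← Units.val_mul]

instance : Group KleinBottleGroup :=
  Group.ofLeftAxioms
    (fun p q r => by ext <;> simp <;> ring)
    (fun p => by ext <;> simp)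
    (fun p => by ext <;> simp)

/-- The projection onto the acting factor. -/
def sHom : KleinBottleGroup →* Multiplicative ℤ where
  toFun p := Multiplicative.ofAdd p.s
  map_one' := rfl
  map_mul' _ _ := rfl

theorem zpow_s (p : KleinBottleGroup) (n : ℤ) : (p ^ n).s = n * p.s := by
  have h := congrArg Multiplicative.toAdd (map_zpow sHom p n)
  rwa [toAdd_zpow, smul_eq_mul] at h

theorem mk_zero_zpow (y n : ℤ) : (⟨y, 0⟩ : KleinBottleGroup) ^ n = ⟨n * y, 0⟩ := by
  let f : Multiplicative ℤ →* KleinBottleGroup :=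
    { toFun := fun k => ⟨k.toAdd * y, 0⟩
      map_one' := by ext <;> simp
      map_mul' := fun k l => by ext <;> simp [sign, add_mul] }
  have h := map_zpow f (Multiplicative.ofAdd 1) n
  simpa [f, ← ofAdd_zsmul] using h.symm

/-- The graph of the endomorphism of the Klein bottle group with `b ↦ (y, 0)` and
`a ↦ (k, d)` where `d = 1` or `d = -1`. -/
def endGraph (y k d : ℤ) (hd : d = 1 ∨ d = -1) :
    Subgroup (KleinBottleGroup × KleinBottleGroup) where
  -- (1 - sign)/2 is the indicator of odd s; doubling avoids the division.
  carrier := {r | r.2.s = d * r.1.s ∧ 2 * r.2.x = 2 * y * r.1.x + k * (1 - r.1.sign)}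
  one_mem' := by simp
  mul_mem' := by
    rintro ⟨p, q⟩ ⟨p', q'⟩ ⟨h₁, h₂⟩ ⟨h₃, h₄⟩
    have hs : q.sign = p.sign := by
      rcases hd with rfl | rfl <;> simp_all [sign, Int.negOnePow_neg]
    refine ⟨by simp_all [mul_add], ?_⟩
    simp only [Prod.mk_mul_mk, mul_x, sign_mul, hs] at *
    linear_combination h₂ + p.sign * h₄
  inv_mem' := by
    rintro ⟨p, q⟩ ⟨h₁, h₂⟩
    have hs : q.sign = p.sign := by
      rcases hd with rfl | rfl <;> simp_all [sign, Int.negOnePow_neg]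
    refine ⟨by simp_all, ?_⟩
    simp only [Prod.inv_mk, inv_x, sign_inv, hs] at *
    linear_combination (-p.sign) * h₂ + k * sign_mul_self p

end KleinBottleGroup

namespace BaumslagSolitar

variable {m : ℤ}

/-- The generator `a`. -/
abbrev a (m n : ℤ) : BaumslagSolitar m n := PresentedGroup.of 0

/-- The generator `b`. -/
abbrev b (m n : ℤ) : BaumslagSolitar m n := PresentedGroup.of 1

theorem relation (m n : ℤ) : (a m n)⁻¹ * b m n ^ m * a m n = b m n ^ n := by
  have h : PresentedGroup.mk {baumslagSolitarRelator m n} (baumslagSolitarRelator m n) = 1 :=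
    PresentedGroup.one_of_mem (Set.mem_singleton _)
  exact mul_inv_eq_one.mp h

theorem mem_of_generators_mem {n : ℤ} (H : Subgroup (BaumslagSolitar m n))
    (ha : a m n ∈ H) (hb : b m n ∈ H) (g : BaumslagSolitar m n) : g ∈ H := by
  have h : Subgroup.closure (Set.range PresentedGroup.of) ≤ H := by
    rw [Subgroup.closure_le]
    rintro _ ⟨i, rfl⟩
    fin_cases i
    · exact ha
    · exact hb
  exact h (by rw [PresentedGroup.closure_range_of]; trivial)

/-- The projection of `B(m,-m)` onto `B(1,-1)`, the Klein bottle group. -/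
def toKlein (m : ℤ) : BaumslagSolitar m (-m) →* KleinBottleGroup :=
  PresentedGroup.toGroup (f := ![⟨0, 1⟩, ⟨1, 0⟩]) (by
    rintro _ rfl
    simp only [baumslagSolitarRelator, map_mul, map_inv, map_zpow, FreeGroup.lift_apply_of,
      Matrix.cons_val_zero, Matrix.cons_val_one, KleinBottleGroup.mk_zero_zpow]
    ext <;> simp [KleinBottleGroup.sign])

@[simp] theorem toKlein_a : toKlein m (a m (-m)) = ⟨0, 1⟩ := PresentedGroup.toGroup.of _

@[simp] theorem toKlein_b : toKlein m (b m (-m)) = ⟨1, 0⟩ := PresentedGroup.toGroup.of _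

theorem toKlein_b_zpow_mul_a_zpow_x (n t : ℤ) :
    (toKlein m (b m (-m) ^ n * a m (-m) ^ t)).x = n := by
  have h : ((⟨0, 1⟩ : KleinBottleGroup) ^ t).x = 0 := by
    let H : Subgroup KleinBottleGroup :=
      { carrier := {p | p.x = 0}
        one_mem' := rfl
        mul_mem' := fun {p q} hp hq => by simp_all
        inv_mem' := fun {p} hp => by simp_all }
    exact H.zpow_mem (show (⟨0, 1⟩ : KleinBottleGroup) ∈ H from rfl) t
  simp [KleinBottleGroup.mk_zero_zpow, h]

theorem toKlein_b_zpow_mul_a_zpow_s (n t : ℤ) :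
    (toKlein m (b m (-m) ^ n * a m (-m) ^ t)).s = t := by
  simp [KleinBottleGroup.zpow_s]

theorem toKlein_surjective : Function.Surjective (toKlein m) := fun p =>
  ⟨b m (-m) ^ p.x * a m (-m) ^ p.s, KleinBottleGroup.ext
    (toKlein_b_zpow_mul_a_zpow_x _ _) (toKlein_b_zpow_mul_a_zpow_s _ _)⟩

/-- Every homomorphism from `B(m,-m)` to the Klein bottle group kills the acting coordinate
of `b`. -/
theorem map_b_s (hm : m ≠ 0) (f : BaumslagSolitar m (-m) →* KleinBottleGroup) :
    (f (b m (-m))).s = 0 := by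
  -- Conjugation by a is invisible to s, so the relation gives m s = -m s.
  have h := congrArg (fun g => (f g).s) (relation m (-m))
  simp only [map_mul, map_inv, map_zpow, KleinBottleGroup.mul_s, KleinBottleGroup.inv_s,
    KleinBottleGroup.zpow_s] at h
  have h' : m * (f (b m (-m))).s = 0 := by linarith
  exact (mul_eq_zero.mp h').resolve_left hm

/-- Every surjection from `B(m,-m)` to the Klein bottle group factors through `toKlein`, via an
automorphism of the Klein bottle group. -/
theorem exists_endGraph (hm : m ≠ 0) (f : BaumslagSolitar m (-m) →* KleinBottleGroup)
    (hf : Function.Surjective f) :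
    ∃ y k d : ℤ, ∃ hd : d = 1 ∨ d = -1, (y = 1 ∨ y = -1) ∧
      ∀ g, (toKlein m g, f g) ∈ KleinBottleGroup.endGraph y k d hd := by
  have hb := map_b_s hm f
  have hs : ∀ g, (f g).s = (f (a m (-m))).s * (toKlein m g).s := by
    intro g
    let H : Subgroup (BaumslagSolitar m (-m)) :=
      { carrier := {g | (f g).s = (f (a m (-m))).s * (toKlein m g).s}
        one_mem' := by simp
        mul_mem' := fun {p q} hp hq => by simp_all [mul_add]
        inv_mem' := fun {p} hp => by simp_all }
    exact mem_of_generators_mem H (by simp [H]) (by simp [H, hb]) g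
  have hd : (f (a m (-m))).s = 1 ∨ (f (a m (-m))).s = -1 := by
    obtain ⟨g, hg⟩ := hf ⟨0, 1⟩
    have h := hs g
    rw [hg] at h
    exact Int.isUnit_iff.mp (IsUnit.of_mul_eq_one _ h.symm)
  have key : ∀ g, (toKlein m g, f g) ∈
      KleinBottleGroup.endGraph (f (b m (-m))).x (f (a m (-m))).x (f (a m (-m))).s hd := by
    intro g
    refine mem_of_generators_mem ((KleinBottleGroup.endGraph _ _ _ hd).comap
      ((toKlein m).prod f)) ?_ ?_ g
    · refine ⟨by simp, ?_⟩
      simp [KleinBottleGroup.sign]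
      ring
    · refine ⟨by simp [hb], ?_⟩
      simp [KleinBottleGroup.sign]
  refine ⟨_, _, _, hd, ?_, key⟩
  obtain ⟨g, hg⟩ := hf ⟨1, 0⟩
  obtain ⟨h₁, h₂⟩ := key g
  rw [hg] at h₁ h₂
  -- A preimage of (1, 0) has s = 0, so the k term drops out and y divides 1.
  have h₀ : (toKlein m g).s = 0 := by
    rcases hd with h | h <;> simp [h] at h₁ <;> omega
  have h₃ : (f (b m (-m))).x * (toKlein m g).x = 1 := by
    simp [KleinBottleGroup.sign, h₀] at h₂
    linarith
  exact Int.isUnit_iff.mp (IsUnit.of_mul_eq_one _ h₃)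

end BaumslagSolitar

/-- Twisted conjugacy is written without inverses, so that coordinates can be read off both sides.
-/
theorem reidemeisterNumber_eq_top_of_forall {G : Type*} [Group G] (φ : G →* G) (u : ℤ → G)
    (hu : ∀ i j g, u j * φ g = g * u i → i = j) : reidemeisterNumber φ = ⊤ := by
  rw [reidemeisterNumber, ENat.card_eq_top]
  refine Infinite.of_injective (fun i => Quotient.mk (twistedConjSetoid φ) (u i)) ?_
  intro i j hij
  obtain ⟨g, hg⟩ : IsTwistedConj φ (u i) (u j) := Quotient.exact hij
  exact hu i j g (by rw [hg]; group)

open BaumslagSolitar in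
theorem theorem5p4 (m : ℤ) (hm : 1 < m)
    (φ : BaumslagSolitar m (-m) ≃* BaumslagSolitar m (-m)) :
    reidemeisterNumber φ.toMonoidHom = ⊤ := by
  obtain ⟨y, k, d, hd, hy, key⟩ := exists_endGraph (by omega)
    ((toKlein m).comp φ.toMonoidHom) (toKlein_surjective.comp φ.surjective)
  rcases hd with rfl | rfl
  -- The factor b^0 lets the coordinate lemmas for b^n a^t apply.
  · refine reidemeisterNumber_eq_top_of_forall _ (fun n => b m (-m) ^ (0 : ℤ) * a m (-m) ^ n) ?_
    intro i j g h
    have hs := congrArg (fun g => (toKlein m g).s) h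
    have hg := (key g).1
    simp only [map_mul (toKlein m) _ (φ.toMonoidHom g), map_mul (toKlein m) g,
      KleinBottleGroup.mul_s, toKlein_b_zpow_mul_a_zpow_s] at hs
    simp only [MonoidHom.comp_apply] at hg
    linarith
  -- On s = 0, φ multiplies x by y; passing a^t multiplies it by (-1)^t. The parity of t makes these
  -- signs cancel.
  · obtain ⟨t, ht⟩ : ∃ t : ℤ, (t.negOnePow : ℤ) * y = 1 := by
      rcases hy with rfl | rfl
      · exact ⟨0, by simp⟩
      · exact ⟨1, by simp⟩
    refine reidemeisterNumber_eq_top_of_forall _ (fun n => b m (-m) ^ n * a m (-m) ^ t) ?_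
    intro i j g h
    have hs := congrArg (fun g => (toKlein m g).s) h
    have hx := congrArg (fun g => (toKlein m g).x) h
    obtain ⟨hg, hg'⟩ := key g
    simp only [map_mul (toKlein m) _ (φ.toMonoidHom g), map_mul (toKlein m) g,
      KleinBottleGroup.mul_s, KleinBottleGroup.mul_x, toKlein_b_zpow_mul_a_zpow_s,
      toKlein_b_zpow_mul_a_zpow_x, KleinBottleGroup.sign] at hs hx
    simp only [MonoidHom.comp_apply, KleinBottleGroup.sign] at hg hg'
    -- Comparing s gives t - s(g) = s(g) + t.
    have h₀ : (toKlein m g).s = 0 := by linarith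
    simp only [h₀, Int.negOnePow_zero, Units.val_one] at hx hg'
    have hg'' : (toKlein m (φ.toMonoidHom g)).x = y * (toKlein m g).x := by linarith
    rw [hg''] at hx
    linear_combination (toKlein m g).x * ht - hx
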